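/- Let $\mathcal B$ be the Borel $\sigma$-field of $\mathbb R$ and let $\gamma\in(0,2]$. Let $Z$ be a real random variable with characteristic function $E\{e^{itZ}\}=\exp(-|t|^\gamma/2)$, $t\in\mathbb R$. For $a\in\mathbb R$ and $b>0$ let $\mathcal S(a,b)$ be the law of $a+b^{1/\gamma}Z$. Let $0=u_0<u_1<u_2<\dots<u$ be real numbers, so that $u_n<u$ for all $n$, and put $u^*=\sup_n u_n$. Define $f_0=0$ and, for $n\ge 0$, $x\in\mathbb R^n$ and $y\in\mathbb R$, $$f_{n+1}(x,y)=f_n(x)\Bigl(1-\Bigl(\tfrac{u_{n+1}-u_n}{u-u_n}\Bigr)^{1/\gamma}\Bigr)+y\,\Bigl(\tfrac{u_{n+1}-u_n}{u-u_n}\Bigr)^{1/\gamma}.$$ For $n\ge 0$ and $x\in\mathbb R^n$ let $\sigma_n(x)=\mathcal S\bigl(f_n(x),\,u-u_n\bigr)$. Let $P_\sigma$ be the unique probability measure on $\mathbb R^\infty$ (with the product $\sigma$-field) under which the coordinate process $(X_n)_{n\ge1}$ satisfies $X_1\sim\sigma_0$ and, for every $n\ge1$, $\sigma_n(x)$ is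 the conditional law of $X_{n+1}$ given $(X_1,\dots,X_n)=x$. For $x\in\mathbb R^\infty$ write $f_n(x)=f_n(x_1,\dots,x_n)$ and $\sigma_n(x)=\sigma_n(x_1,\dots,x_n)$. Let $$L=\{x\in\mathbb R^\infty:\ \lim_n f_n(x)\text{ exists and is finite}\},\qquad f(x)=\lim_n f_n(x)\ \text{ for } x\in L.$$ Then, for every $x\in L$: - if $u^*=u$, then $\sigma_n(x)\to\delta_{f(x)}$ weakly; - if $u^*<u$, then $\sigma_n(x)\to\mathcal S\bigl(f(x),\,u-u^*\bigr)$ in total variation distance $\|\lambda_1-\lambda_2\|=\sup_{A\in\mathcal B}|\lambda_1(A)-\lambda_2(A)|$. Moreover, $P_\sigma(L)=1$, and $f$ has law $\mathcal S(0,u^*)$ under $P_\sigma$, that is, $P_\sigma(\{x\in L:\ f(x)\in A\})=\mathcal S(0,u^*)(A)$ for all $A\in\mathcal B$. -/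

import Mathlib

open MeasureTheory ProbabilityTheory Filter Topology

namespace StablePrediction

/-! ### Existence of the standard symmetric stable laws -/

lemma exists_charFun_pow (μ : Measure ℝ) [IsProbabilityMeasure μ] (n : ℕ) :
    ∃ ν : Measure ℝ, IsProbabilityMeasure ν ∧ ∀ t, charFun ν t = charFun μ t ^ n := by
  induction n with
  | zero => exact ⟨Measure.dirac 0, inferInstance, fun t => by simp [charFun_dirac]⟩
  | succ n ih =>
    obtain ⟨ν, hν, h⟩ := ih
    exact ⟨ν.conv μ, inferInstance, fun t => by rw [charFun_conv, h, pow_succ]⟩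

lemma exists_of_tendsto_charFun (μ : ℕ → ProbabilityMeasure ℝ) {f : ℝ → ℂ}
    (hf : ContinuousAt f 0)
    (h : ∀ t, Tendsto (fun n => charFun (μ n : Measure ℝ) t) atTop (𝓝 (f t))) :
    ∃ ν : ProbabilityMeasure ℝ, ∀ t, charFun (ν : Measure ℝ) t = f t := by
  have h_tight : IsTightMeasureSet {((ρ : ProbabilityMeasure ℝ) : Measure ℝ) | ρ ∈ Set.range μ} := by
    have := isTightMeasureSet_of_tendsto_charFun (μ := fun n => (μ n : Measure ℝ)) hf h
    convert this using 1
    ext; simp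
  have h_compact := isCompact_closure_of_isTightMeasureSet h_tight
  obtain ⟨ν, -, hν⟩ := h_compact.ultrafilter_le_nhds ((hyperfilter ℕ).map μ)
    (by
      refine le_trans ?_ (principal_mono.2 subset_closure)
      simp)
  refine ⟨ν, fun t => ?_⟩
  have hν' : Tendsto μ (hyperfilter ℕ : Filter ℕ) (𝓝 ν) := hν
  rw [ProbabilityMeasure.tendsto_iff_forall_integral_rclike_tendsto ℂ] at hν'
  have h1 := hν' (BoundedContinuousFunction.innerProbChar t)
  simp_rw [← charFun_eq_integral_innerProbChar] at h1
  exact tendsto_nhds_unique h1 ((h t).mono_left (Nat.hyperfilter_le_atTop))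

lemma exists_asymp (γ : ℝ) (h0 : 0 < γ) (h2 : γ < 2) :
    ∃ (μ : Measure ℝ) (g : ℝ → ℝ) (c : ℝ), IsProbabilityMeasure μ ∧ 0 < c ∧
      (∀ t, charFun μ t = g t) ∧ (∀ t, g (-t) = g t) ∧
      Tendsto (fun t => (1 - g t) / t ^ γ) (𝓝[>] 0) (𝓝 c) := by
  have hP : IsProbabilityMeasure (paretoMeasure 1 γ) :=
    isProbabilityMeasure_paretoMeasure one_pos h0
  set P := paretoMeasure 1 γ with hPdef
  have hPn : IsProbabilityMeasure (P.map (fun x => (-1) * x)) :=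
    Measure.isProbabilityMeasure_map (by fun_prop)
  let k : ℝ → ℝ := fun y => (1 - Real.cos y) * y ^ (-(γ + 1))
  have hkm : Measurable k := by fun_prop
  have hknn : ∀ y ∈ Set.Ioi (0:ℝ), 0 ≤ k y := fun y hy =>
    mul_nonneg (by linarith [Real.cos_le_one y]) (Real.rpow_nonneg (le_of_lt hy) _)
  have hki : IntegrableOn k (Set.Ioi 0) := by
    rw [← Set.Ioc_union_Ioi_eq_Ioi (zero_le_one' ℝ)]
    refine IntegrableOn.union ?_ ?_
    · have : IntegrableOn (fun y : ℝ => y ^ (1 - γ)) (Set.Ioc 0 1) := by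
        rw [← intervalIntegrable_iff_integrableOn_Ioc_of_le zero_le_one]
        exact intervalIntegral.intervalIntegrable_rpow' (by linarith)
      refine Integrable.mono' this hkm.aestronglyMeasurable ?_
      refine (ae_restrict_iff' measurableSet_Ioc).2 (ae_of_all _ fun y hy => ?_)
      rw [Real.norm_of_nonneg (hknn y hy.1)]
      have e : y ^ (1 - γ) = y ^ 2 * y ^ (-(γ + 1)) := by
        rw [← Real.rpow_natCast, ← Real.rpow_add hy.1]; congr 1; push_cast; ring
      rw [e]
      refine mul_le_mul_of_nonneg_right ?_ (Real.rpow_nonneg hy.1.le _)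
      nlinarith [Real.one_sub_sq_div_two_le_cos (x := y), sq_nonneg y]
    · have : IntegrableOn (fun y : ℝ => 2 * y ^ (-(γ + 1))) (Set.Ioi 1) :=
        (integrableOn_Ioi_rpow_of_lt (by linarith) one_pos).const_mul 2
      refine Integrable.mono' this hkm.aestronglyMeasurable ?_
      refine (ae_restrict_iff' measurableSet_Ioi).2 (ae_of_all _ fun y hy => ?_)
      have hy0 : (0:ℝ) < y := lt_trans one_pos hy
      rw [Real.norm_of_nonneg (hknn y hy0)]
      refine mul_le_mul_of_nonneg_right ?_ (Real.rpow_nonneg hy0.le _)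
      linarith [Real.neg_one_le_cos y]
  have hkpos : 0 < ∫ y in Set.Ioi 0, k y := by
    have h1 : (0:ℝ) < ∫ y in (0:ℝ)..1, k y := by
      refine intervalIntegral.intervalIntegral_pos_of_pos_on ?_ ?_ one_pos
      · rw [intervalIntegrable_iff_integrableOn_Ioc_of_le zero_le_one]
        exact hki.mono_set (fun x hx => hx.1)
      · intro y hy
        refine mul_pos ?_ (Real.rpow_pos_of_pos hy.1 _)
        have := Real.cos_lt_cos_of_nonneg_of_le_pi le_rfl
          (hy.2.le.trans (by linarith [Real.pi_gt_three])) hy.1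
        rw [Real.cos_zero] at this
        linarith
    rw [intervalIntegral.integral_of_le zero_le_one] at h1
    refine lt_of_lt_of_le h1 (setIntegral_mono_set hki ?_ ?_)
    · exact (ae_restrict_iff' measurableSet_Ioi).2 (ae_of_all _ hknn)
    · exact ae_of_all _ (fun x hx => hx.1)
  refine ⟨(2⁻¹ : ENNReal) • P + (2⁻¹ : ENNReal) • P.map (fun x => (-1) * x),
    fun t => ∫ x, Real.cos (t * x) ∂P, γ * ∫ y in Set.Ioi 0, k y, ⟨?_⟩, by positivity, ?_, ?_, ?_⟩
  · simp only [Measure.coe_add, Measure.coe_smul, Pi.add_apply, Pi.smul_apply, measure_univ,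
      smul_eq_mul, mul_one, ENNReal.inv_two_add_inv_two]
  · intro t
    have hi : ∀ r : ℝ, Integrable (fun x : ℝ => Complex.exp (r * x * Complex.I)) P := fun r => by
      refine Integrable.of_bound (C := 1) (by fun_prop) (ae_of_all _ fun x => ?_)
      rw [← Complex.ofReal_mul, Complex.norm_exp_ofReal_mul_I]
    have hi' : Integrable (fun x : ℝ => Complex.exp (t * x * Complex.I))
        (P.map (fun x => (-1) * x)) := by
      refine Integrable.of_bound (C := 1) (by fun_prop) (ae_of_all _ fun x => ?_)
      rw [← Complex.ofReal_mul, Complex.norm_exp_ofReal_mul_I]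
    rw [charFun_apply_real, integral_add_measure ((hi t).smul_measure (by simp))
      (hi'.smul_measure (by simp)), integral_smul_measure, integral_smul_measure,
      ← charFun_apply_real, ← charFun_apply_real, charFun_map_mul, charFun_apply_real,
      charFun_apply_real, ← smul_add, ← integral_add (hi t) (hi _), ← integral_complex_ofReal,
      ← integral_smul]
    refine integral_congr_ae (ae_of_all _ fun x => ?_)
    simp only [ENNReal.toReal_inv, ENNReal.toReal_ofNat, Complex.ofReal_cos, Complex.cos,
      Complex.real_smul]
    push_cast
    ring_nf
  · intro t
    simp
  · have hlim : Tendsto (fun t => ∫ y in Set.Ioi t, k y) (𝓝[>] (0:ℝ))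
        (𝓝 (∫ y in Set.Ioi 0, k y)) := by
      have h := (aecover_Ioi_of_Ioi (μ := volume) (A := (0:ℝ)) (l := 𝓝[>] (0:ℝ))
        (a := fun t => t) (tendsto_id.mono_left nhdsWithin_le_nhds)).integral_tendsto_of_countably_generated hki
      refine h.congr' ?_
      filter_upwards [self_mem_nhdsWithin] with t ht
      rw [Measure.restrict_restrict measurableSet_Ioi,
        Set.inter_eq_left.2 (Set.Ioi_subset_Ioi (le_of_lt ht))]
    refine (hlim.const_mul γ).congr' ?_
    filter_upwards [self_mem_nhdsWithin] with t ht
    have ht : 0 < t := ht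
    have hci : Integrable (fun x => Real.cos (t * x)) P :=
      Integrable.of_bound (C := 1) (by fun_prop) (ae_of_all _ fun x => Real.abs_cos_le_one _)
    have e1 : 1 - ∫ x, Real.cos (t * x) ∂P = ∫ x, (1 - Real.cos (t * x)) ∂P := by
      rw [integral_sub (integrable_const _) hci]; simp
    have e2 : ∫ x, (1 - Real.cos (t * x)) ∂P
        = ∫ x in Set.Ioi 1, γ * t ^ (γ + 1) * k (t * x) := by
      rw [hPdef, paretoMeasure, integral_withDensity_eq_integral_toReal_smul (by
        unfold paretoPDF; fun_prop) (ae_of_all _ fun x => by simp [paretoPDF]),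
        ← integral_Ici_eq_integral_Ioi, ← integral_indicator measurableSet_Ici]
      refine integral_congr_ae (ae_of_all _ fun x => ?_)
      by_cases hx : 1 ≤ x
      · have hx0 : 0 < x := lt_of_lt_of_le one_pos hx
        rw [Set.indicator_of_mem (Set.mem_Ici.2 hx)]
        simp only [paretoPDF_of_le hx, smul_eq_mul, k]
        rw [ENNReal.toReal_ofReal (by positivity), Real.mul_rpow ht.le hx0.le,
          Real.rpow_neg ht.le]
        have := Real.rpow_pos_of_pos ht (γ + 1)
        simp only [Real.one_rpow]
        field_simp
      · rw [Set.indicator_of_notMem (by simpa using hx)]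
        simp [paretoPDF_of_lt (not_le.1 hx)]
    rw [e1, e2, integral_const_mul, integral_comp_mul_left_Ioi k 1 ht, mul_one,
      Real.rpow_add ht, Real.rpow_one, smul_eq_mul]
    have := Real.rpow_pos_of_pos ht γ
    field_simp

lemma exists_stable (γ : ℝ) (h0 : 0 < γ) (h2 : γ ≤ 2) :
    ∃ ν : ProbabilityMeasure ℝ, ∀ t : ℝ,
      charFun (ν : Measure ℝ) t = Complex.exp (-((|t| ^ γ / 2 : ℝ) : ℂ)) := by
  rcases h2.eq_or_lt with rfl | h2
  · refine ⟨⟨gaussianReal 0 1, inferInstance⟩, fun t => ?_⟩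
    simp [charFun_gaussianReal]
  obtain ⟨μ, g, c, hμ, hc, hg, hge, hl⟩ := exists_asymp γ h0 h2
  choose ν hν hνc using exists_charFun_pow μ
  let s : ℝ := (2 * c) ^ (-1 / γ)
  have hs : 0 < s := by positivity
  have hsγ : s ^ γ = (2 * c)⁻¹ := by
    rw [← Real.rpow_mul (by positivity), div_mul_cancel₀ _ h0.ne', Real.rpow_neg_one]
  let a : ℕ → ℝ := fun n => s * (n : ℝ) ^ (-1 / γ)
  have ha : ∀ n, IsProbabilityMeasure ((ν n).map (fun x => a n * x)) := fun n =>
    Measure.isProbabilityMeasure_map (by fun_prop)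
  refine exists_of_tendsto_charFun (fun n => ⟨(ν n).map (fun x => a n * x), ha n⟩) ?_ ?_
  · refine Continuous.continuousAt ?_
    have : Continuous fun t : ℝ => |t| ^ γ := continuous_abs.rpow_const (fun _ => Or.inr h0.le)
    fun_prop
  · intro t
    simp only [ProbabilityMeasure.coe_mk, charFun_map_mul, hνc, hg]
    rw [← Complex.ofReal_neg, ← Complex.ofReal_exp]
    simp_rw [← Complex.ofReal_pow]
    refine (Complex.continuous_ofReal.tendsto _).comp ?_
    have habs : ∀ t, g t = g |t| := fun t => by
      rcases abs_choice t with h | h <;> rw [h]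
      rw [hge]
    rcases eq_or_ne t 0 with rfl | ht
    · have : g 0 = 1 := by
        have := hg 0
        simp at this
        exact_mod_cast this.symm
      simp [this, Real.zero_rpow h0.ne']
    have e : ∀ n, g (a n * t) = 1 + -(1 - g (a n * |t|)) := fun n => by
      rw [habs, abs_mul, abs_of_nonneg (by positivity : 0 ≤ a n)]; ring
    simp_rw [e]
    apply Real.tendsto_one_add_pow_exp_of_tendsto
    have hat : Tendsto (fun n => a n * |t|) atTop (𝓝[>] 0) := by
      refine tendsto_nhdsWithin_iff.2 ⟨?_, ?_⟩
      · have : Tendsto (fun n : ℕ => (n : ℝ) ^ (-1 / γ)) atTop (𝓝 0) := by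
          have := (tendsto_rpow_neg_atTop (y := 1 / γ) (by positivity)).comp
            (tendsto_natCast_atTop_atTop (R := ℝ))
          simpa [neg_div, Function.comp_def] using this
        simpa [a] using (this.const_mul s).mul_const |t|
      · filter_upwards [eventually_gt_atTop 0] with n hn
        have : (0:ℝ) < n := by exact_mod_cast hn
        have := abs_pos.2 ht
        simp only [a, Set.mem_Ioi]; positivity
    have h3 := ((hl.comp hat).mul_const (s ^ γ * |t| ^ γ)).neg
    have e2 : -(c * (s ^ γ * |t| ^ γ)) = -(|t| ^ γ / 2) := by
      rw [hsγ]; field_simp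
    rw [e2] at h3
    refine h3.congr' ?_
    filter_upwards [eventually_gt_atTop 0] with n hn
    have hn' : (0:ℝ) < n := by exact_mod_cast hn
    have e3 : (a n * |t|) ^ γ = (s ^ γ * |t| ^ γ) / n := by
      simp only [a]
      rw [Real.mul_rpow (by positivity) (by positivity), Real.mul_rpow (by positivity) (by positivity),
        ← Real.rpow_mul hn'.le, div_mul_cancel₀ _ h0.ne', Real.rpow_neg_one]
      ring
    have := abs_pos.2 ht
    have h4 : 0 < s ^ γ * |t| ^ γ := by positivity
    simp only [Function.comp]
    rw [e3]
    field_simp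

/-- The law of `Z`: the probability measure on `ℝ` whose characteristic function is
`t ↦ exp (-|t| ^ γ / 2)`, for `γ ∈ (0, 2]`. -/
noncomputable def stdStable (γ : Set.Ioc (0 : ℝ) 2) : ProbabilityMeasure ℝ :=
  Classical.choose (exists_stable γ γ.2.1 γ.2.2)

lemma charFun_stdStable (γ : Set.Ioc (0 : ℝ) 2) (t : ℝ) :
    charFun (stdStable γ : Measure ℝ) t = Complex.exp (-((|t| ^ (γ : ℝ) / 2 : ℝ) : ℂ)) :=
  Classical.choose_spec (exists_stable γ γ.2.1 γ.2.2) t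

/-- The stable law `S(a, b)`: the law of `a + b ^ (1 / γ) * Z`. -/
noncomputable def stableLaw (γ : Set.Ioc (0 : ℝ) 2) (a b : ℝ) : ProbabilityMeasure ℝ :=
  (stdStable γ).map (f := fun z => a + b ^ (1 / (γ : ℝ)) * z) (by fun_prop)

lemma measurable_stableLaw (γ : Set.Ioc (0 : ℝ) 2) (b : ℝ) :
    Measurable fun a : ℝ => (stableLaw γ a b : Measure ℝ) := by
  refine Measure.measurable_of_measurable_coe _ fun A hA => ?_
  have h : Measurable fun p : ℝ × ℝ => p.1 + b ^ (1 / (γ : ℝ)) * p.2 := by fun_prop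
  have e : (fun a : ℝ => (stableLaw γ a b : Measure ℝ) A) = fun a =>
      (stdStable γ : Measure ℝ)
        (Prod.mk a ⁻¹' ((fun p : ℝ × ℝ => p.1 + b ^ (1 / (γ : ℝ)) * p.2) ⁻¹' A)) := by
    funext a
    rw [stableLaw, ProbabilityMeasure.toMeasure_map, Measure.map_apply (by fun_prop) hA]
    rfl
  rw [e]
  exact measurable_measure_prodMk_left (h hA)

/-! ### Strategies -/

/-- A strategy on `S`: for every `n`, a probability kernel from `S ^ n` to `S`. The single
measure of `predictive 0` is the law of the first observation; `predictive n x` is the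
predictive law of the next observation after the observations `x`. -/
structure Strategy (S : Type*) [MeasurableSpace S] where
  predictive : (n : ℕ) → Kernel (Fin n → S) S
  isMarkov : ∀ n, IsMarkovKernel (predictive n)

namespace Strategy

variable {S : Type*} [MeasurableSpace S]

/-- The probability measure `σ_n(x)`, for a sequence `x` of which only the first `n` terms
are used. The sequence is indexed from `0`. -/
noncomputable def law (σ : Strategy S) (n : ℕ) (x : ℕ → S) : ProbabilityMeasure S :=
  ⟨σ.predictive n fun i => x i, (σ.isMarkov n).isProbabilityMeasure _⟩

/-- The Ionescu-Tulcea measure `P_σ` on the space of sequences: the first term has law `σ_0`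
and the conditional law of the term of index `n + 1` given the terms of index `≤ n` is
`σ_{n+1}`. -/
noncomputable def measure (σ : Strategy S) : Measure (ℕ → S) :=
  haveI := σ.isMarkov
  Kernel.trajMeasure (X := fun _ => S) (σ.predictive 0 Fin.elim0) fun n =>
    (σ.predictive (n + 1)).comap
      (fun (y : (i : Finset.Iic n) → S) (i : Fin (n + 1)) =>
        y ⟨i, Finset.mem_Iic.2 (Nat.le_of_lt_succ i.2)⟩)
      (by fun_prop)

end Strategy

/-- The total variation distance `sup_A |μ(A) - ν(A)|`, over the measurable sets `A`. -/
noncomputable def tvDist {S : Type*} [MeasurableSpace S] (μ ν : ProbabilityMeasure S) : ℝ :=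
  ⨆ A : {A : Set S // MeasurableSet A}, |(μ : Measure S).real A - (ν : Measure S).real A|

/-! ### Prediction via stable laws -/

/-- The location `f_n(x)` for `x ∈ ℝ ^ n`: `f_0 = 0` and
`f_{n+1}(x, y) = f_n(x) (1 - w_n) + y w_n`, where
`w_n = ((u_{n+1} - u_n) / (U - u_n)) ^ (1 / γ)`. Here `u` is the sequence and `U` is the number
that bounds it. -/
noncomputable def location (γ : Set.Ioc (0 : ℝ) 2) (u : ℕ → ℝ) (U : ℝ) :
    (n : ℕ) → (Fin n → ℝ) → ℝ
  | 0, _ => 0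
  | n + 1, x =>
      location γ u U n (fun i => x i.castSucc) *
          (1 - ((u (n + 1) - u n) / (U - u n)) ^ (1 / (γ : ℝ))) +
        x (Fin.last n) * ((u (n + 1) - u n) / (U - u n)) ^ (1 / (γ : ℝ))

lemma measurable_location (γ : Set.Ioc (0 : ℝ) 2) (u : ℕ → ℝ) (U : ℝ) (n : ℕ) :
    Measurable (location γ u U n) := by
  induction n with
  | zero => exact measurable_const
  | succ n ih =>
    simp only [location]
    exact ((ih.comp (by fun_prop)).mul_const _).add ((measurable_pi_apply _).mul_const _)

/-- The strategy `σ_n(x) = S(f_n(x), U - u_n)`. -/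
noncomputable def stableStrategy (γ : Set.Ioc (0 : ℝ) 2) (u : ℕ → ℝ) (U : ℝ) : Strategy ℝ where
  predictive n :=
    { toFun := fun x => (stableLaw γ (location γ u U n x) (U - u n) : Measure ℝ)
      measurable' := (measurable_stableLaw γ _).comp (measurable_location γ u U n) }
  isMarkov n := ⟨fun x => (stableLaw γ (location γ u U n x) (U - u n)).2⟩

/-- The sequences `x` along which `f_n(x)` has a finite limit. -/
def convSet (γ : Set.Ioc (0 : ℝ) 2) (u : ℕ → ℝ) (U : ℝ) : Set (ℕ → ℝ) :=
  {x | ∃ l : ℝ, Tendsto (fun n => location γ u U n fun i => x i) atTop (𝓝 l)}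

/-- The limit `f(x) = lim_n f_n(x)`. It is only meaningful for `x ∈ convSet γ u U`. -/
noncomputable def limitLocation (γ : Set.Ioc (0 : ℝ) 2) (u : ℕ → ℝ) (U : ℝ) (x : ℕ → ℝ) : ℝ :=
  limUnder atTop fun n => location γ u U n fun i => x i

end StablePrediction

namespace StablePrediction
-- Given the past, the next observation is `f_n + (U - u_n) ^ (1 / γ) * Z`, so the weight `w_n`
-- makes `f_{n+1} - f_n` a copy of `(u_{n+1} - u_n) ^ (1 / γ) * Z` whose law does not depend on the
-- past: `f_n` behaves like a symmetric stable process sampled at the times `u_n`.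
--
-- Hence `exp (i t f_n + u_n |t| ^ γ / 2)` is a bounded martingale (`martingale_expLocation`). Its
-- constant mean gives the characteristic function of `f_n`, and its almost sure convergence gives
-- that of `exp (i t f_n)` for each `t`. Fubini and a Gaussian average over `t` turn the latter into
-- convergence of `f_n` itself (`exists_tendsto_of_ae_exp_tendsto`, `ae_mem_convSet`), and dominated
-- convergence identifies the law of the limit (`map_limitLocation`).
--
-- On `convSet` the parameters of `σ_n(x)` converge. If the limiting scale is `0`, characteristic
-- functions give weak convergence. If it is positive, total variation convergence follows from `Z`
-- having a density, because translations and dilations act continuously in `L¹`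
-- (`tendsto_iSup_abs_map_affine_sub`).
lemma charFun_stableLaw (γ : Set.Ioc (0 : ℝ) 2) (a : ℝ) {b : ℝ} (hb : 0 ≤ b) (t : ℝ) :
    charFun (stableLaw γ a b : Measure ℝ) t =
      Complex.exp (t * a * Complex.I - ((b * |t| ^ (γ : ℝ) / 2 : ℝ) : ℂ)) := by
  have hγ : (0 : ℝ) < γ := γ.2.1
  have h : |b ^ (1 / (γ : ℝ)) * t| ^ (γ : ℝ) = b * |t| ^ (γ : ℝ) := by
    rw [abs_mul, Real.mul_rpow (abs_nonneg _) (abs_nonneg _), abs_of_nonneg (by positivity),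
      ← Real.rpow_mul hb, one_div_mul_cancel hγ.ne', Real.rpow_one]
  have h' := charFun_stdStable γ (b ^ (1 / (γ : ℝ)) * t)
  rw [stableLaw, ProbabilityMeasure.toMeasure_map, charFun_apply_real,
    integral_map (by fun_prop) (by fun_prop)]
  rw [h, charFun_apply_real] at h'
  rw [sub_eq_add_neg, Complex.exp_add, ← h', ← integral_const_mul]
  refine integral_congr_ae (ae_of_all _ fun x => ?_)
  simp only [← Complex.exp_add]
  congr 1
  push_cast
  ring

/-! ### Finite-dimensional laws of the Ionescu-Tulcea measure -/

namespace Strategy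

variable {S : Type*} [MeasurableSpace S]

instance isProbabilityMeasure_measure (σ : Strategy S) : IsProbabilityMeasure σ.measure := by
  have := σ.isMarkov
  unfold measure
  infer_instance

lemma map_measure_eval_zero (σ : Strategy S) :
    σ.measure.map (fun x => x 0) = σ.predictive 0 Fin.elim0 := by
  have := σ.isMarkov
  have e : (fun x : ℕ → S => x 0) =
      MeasurableEquiv.piUnique (fun _ : Finset.Iic 0 => S) ∘ Preorder.frestrictLe 0 := rfl
  rw [e, ← Measure.map_map (by fun_prop) (by fun_prop), measure, Kernel.trajMeasure,
    Measure.map_comp _ _ (by fun_prop), Kernel.traj_map_frestrictLe, Kernel.partialTraj_self,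
    Measure.id_comp, Measure.map_map (by fun_prop) (by fun_prop), MeasurableEquiv.self_comp_symm,
    Measure.map_id]

/-- One more term of the sequence has conditional law `σ_n` given the first `n` terms. -/
lemma map_measure_compProd (σ : Strategy S) (n : ℕ) :
    haveI := σ.isMarkov
    (σ.measure.map fun x (i : Fin n) => x i) ⊗ₘ σ.predictive n =
      σ.measure.map fun x => ((fun i : Fin n => x i), x n) := by
  have := σ.isMarkov
  have hm : ∀ n, Measurable fun (x : ℕ → S) (i : Fin n) => x i := fun n => by fun_prop
  ext s hs
  rw [Measure.compProd_apply hs, lintegral_map (Kernel.measurable_kernel_prodMk_left hs) (hm n),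
    Measure.map_apply (by fun_prop) hs]
  -- `predictive 0` enters `trajMeasure` as the initial law and `predictive (n + 1)` as its kernel
  -- of index `n`, so the two cases rest on different facts.
  cases n with
  | zero =>
    have e : ∀ x : ℕ → S, (fun i : Fin 0 => x i) = Fin.elim0 := fun x => Subsingleton.elim _ _
    simp_rw [e]
    rw [lintegral_const, measure_univ, mul_one]
    rw [← map_measure_eval_zero, Measure.map_apply (by fun_prop) (measurable_prodMk_left hs)]
    rfl
  | succ n =>
    let e : ((i : Finset.Iic n) → S) → Fin (n + 1) → S := fun y i =>
      y ⟨i, Finset.mem_Iic.2 (Nat.le_of_lt_succ i.2)⟩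
    have he : Measurable e := by fun_prop
    have h := Kernel.map_frestrictLe_trajMeasure_compProd_eq_map_trajMeasure (X := fun _ => S)
      (μ₀ := σ.predictive 0 Fin.elim0) (κ := fun n => (σ.predictive (n + 1)).comap
      (fun (y : (i : Finset.Iic n) → S) (i : Fin (n + 1)) =>
        y ⟨i, Finset.mem_Iic.2 (Nat.le_of_lt_succ i.2)⟩) (by fun_prop)) (a := n)
    have hs' : MeasurableSet ((fun p : ((i : Finset.Iic n) → S) × S => (e p.1, p.2)) ⁻¹' s) :=
      (show Measurable fun p : ((i : Finset.Iic n) → S) × S => (e p.1, p.2) by fun_prop) hs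
    have h2 := congrArg (fun μ => μ ((fun p : ((i : Finset.Iic n) → S) × S => (e p.1, p.2)) ⁻¹' s)) h
    beta_reduce at h2
    rw [Measure.compProd_apply hs', lintegral_map (Kernel.measurable_kernel_prodMk_left hs')
      (by fun_prop), Measure.map_apply (by fun_prop) hs'] at h2
    exact h2

end Strategy

/-! ### The exponential martingale -/

/-- The filtration on sequences generated by the first `n` terms. -/
def prefixFiltration (S : Type*) [m : MeasurableSpace S] :
    Filtration ℕ (MeasurableSpace.pi : MeasurableSpace (ℕ → S)) where
  seq n := MeasurableSpace.comap (fun x (i : Fin n) => x i) MeasurableSpace.pi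
  mono' := by
    intro m n hmn
    have e : (fun (x : ℕ → S) (i : Fin m) => x i) =
        (fun (y : Fin n → S) (i : Fin m) => y (Fin.castLE hmn i)) ∘
          fun (x : ℕ → S) (i : Fin n) => x i := rfl
    show MeasurableSpace.comap (fun (x : ℕ → S) (i : Fin m) => x i) _ ≤ _
    rw [e, ← MeasurableSpace.comap_comp]
    exact MeasurableSpace.comap_mono (Measurable.comap_le (by fun_prop))
  le' n := Measurable.comap_le (by fun_prop)

/-- The weight `((u_{n+1} - u_n) / (U - u_n)) ^ (1 / γ)` of a new observation. -/
noncomputable def weight (γ : Set.Ioc (0 : ℝ) 2) (u : ℕ → ℝ) (U : ℝ) (n : ℕ) : ℝ :=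
  ((u (n + 1) - u n) / (U - u n)) ^ (1 / (γ : ℝ))

/-- The normalized exponential `exp (i t f_n(x) + u_n |t| ^ γ / 2)`. -/
noncomputable def expLocation (γ : Set.Ioc (0 : ℝ) 2) (u : ℕ → ℝ) (U t : ℝ) (n : ℕ)
    (y : Fin n → ℝ) : ℂ :=
  Complex.exp (t * location γ u U n y * Complex.I + ((u n * |t| ^ (γ : ℝ) / 2 : ℝ) : ℂ))

lemma measurable_expLocation (γ : Set.Ioc (0 : ℝ) 2) (u : ℕ → ℝ) (U t : ℝ) (n : ℕ) :
    Measurable (expLocation γ u U t n) := by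
  have := measurable_location γ u U n
  unfold expLocation
  fun_prop

lemma norm_expLocation (γ : Set.Ioc (0 : ℝ) 2) (u : ℕ → ℝ) (U t : ℝ) (n : ℕ) (y : Fin n → ℝ) :
    ‖expLocation γ u U t n y‖ = Real.exp (u n * |t| ^ (γ : ℝ) / 2) := by
  rw [expLocation, Complex.exp_add, norm_mul, ← Complex.ofReal_mul, Complex.norm_exp_ofReal_mul_I,
    one_mul, ← Complex.ofReal_exp, Complex.norm_real, Real.norm_of_nonneg (Real.exp_pos _).le]

variable {γ : Set.Ioc (0 : ℝ) 2} {u : ℕ → ℝ} {U : ℝ}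

/-- The one-step martingale identity: integrating out the new observation produces the factor `exp
(-(u_{n+1} - u_n) |t| ^ γ / 2)`, which is exactly the change of normalization. -/
lemma integral_exp_stableLaw (hu : StrictMono u) (huU : ∀ n, u n < U) (t a : ℝ) (n : ℕ) :
    ∫ z, Complex.exp (t * (a * (1 - weight γ u U n) + z * weight γ u U n : ℝ) * Complex.I +
        ((u (n + 1) * |t| ^ (γ : ℝ) / 2 : ℝ) : ℂ)) ∂(stableLaw γ a (U - u n) : Measure ℝ) =
      Complex.exp (t * a * Complex.I + ((u n * |t| ^ (γ : ℝ) / 2 : ℝ) : ℂ)) := by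
  have hγ : (0 : ℝ) < γ := γ.2.1
  have h1 : 0 < U - u n := sub_pos.2 (huU n)
  have h2 : 0 < u (n + 1) - u n := sub_pos.2 (hu n.lt_succ_self)
  have hw : 0 ≤ weight γ u U n := by unfold weight; positivity
  -- The reason for the form of the weight: its `γ`-th power cancels the predictive scale `U - u n`.
  have hwγ : (U - u n) * |t * weight γ u U n| ^ (γ : ℝ) = (u (n + 1) - u n) * |t| ^ (γ : ℝ) := by
    rw [abs_mul, Real.mul_rpow (abs_nonneg _) (abs_nonneg _), abs_of_nonneg hw, weight,
      ← Real.rpow_mul (by positivity), one_div_mul_cancel hγ.ne', Real.rpow_one]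
    field_simp
  have h := charFun_stableLaw γ a h1.le (t * weight γ u U n)
  rw [hwγ, charFun_apply_real] at h
  have e : ∀ z : ℝ, Complex.exp (t * (a * (1 - weight γ u U n) + z * weight γ u U n : ℝ) *
      Complex.I + ((u (n + 1) * |t| ^ (γ : ℝ) / 2 : ℝ) : ℂ)) =
      Complex.exp (t * a * (1 - weight γ u U n) * Complex.I +
        ((u (n + 1) * |t| ^ (γ : ℝ) / 2 : ℝ) : ℂ)) *
      Complex.exp ((t * weight γ u U n : ℝ) * z * Complex.I) := fun z => by
    rw [← Complex.exp_add]
    congr 1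
    push_cast
    ring
  simp_rw [e]
  rw [integral_const_mul, h, ← Complex.exp_add]
  congr 1
  push_cast
  ring

lemma integrable_expLocation (t : ℝ) (n : ℕ) :
    Integrable (fun x : ℕ → ℝ => expLocation γ u U t n fun i => x i)
      (stableStrategy γ u U).measure :=
  Integrable.of_bound (C := Real.exp (u n * |t| ^ (γ : ℝ) / 2))
    ((measurable_expLocation γ u U t n).comp (by fun_prop)).aestronglyMeasurable
    (ae_of_all _ fun x => (norm_expLocation γ u U t n _).le)

/-- The normalized exponential is a complex martingale. -/
lemma martingale_expLocation (hu : StrictMono u) (huU : ∀ n, u n < U) (t : ℝ) :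
    Martingale (fun n (x : ℕ → ℝ) => expLocation γ u U t n fun i => x i) (prefixFiltration ℝ)
      (stableStrategy γ u U).measure := by
  refine martingale_of_setIntegral_eq_succ (fun n => ?_) (integrable_expLocation t) ?_
  · exact ((measurable_expLocation γ u U t n).comp (comap_measurable _)).stronglyMeasurable
  rintro n _ ⟨s, hs, rfl⟩
  have := (stableStrategy γ u U).isMarkov
  have hm : Measurable fun (x : ℕ → ℝ) (i : Fin n) => x i := by fun_prop
  let g : (Fin n → ℝ) × ℝ → ℂ := fun p =>
    Complex.exp (t * (location γ u U n p.1 * (1 - weight γ u U n) + p.2 * weight γ u U n : ℝ) *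
      Complex.I + ((u (n + 1) * |t| ^ (γ : ℝ) / 2 : ℝ) : ℂ))
  have hg : Measurable g := by
    have := measurable_location γ u U n
    fun_prop
  have hgi : Integrable g ((stableStrategy γ u U).measure.map
      fun x => ((fun i : Fin n => x i), x n)) := by
    rw [integrable_map_measure hg.aestronglyMeasurable (by fun_prop)]
    exact integrable_expLocation t (n + 1)
  have e1 : ∫ x in (fun (x : ℕ → ℝ) (i : Fin n) => x i) ⁻¹' s,
      expLocation γ u U t (n + 1) (fun i => x i) ∂(stableStrategy γ u U).measure =
      ∫ p in s ×ˢ Set.univ, g p ∂((stableStrategy γ u U).measure.map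
        fun x => ((fun i : Fin n => x i), x n)) := by
    rw [setIntegral_map (hs.prod .univ) hg.aestronglyMeasurable (by fun_prop), Set.prod_univ]
    rfl
  have e2 : ∀ y : Fin n → ℝ, ∫ z in Set.univ, g (y, z) ∂(stableStrategy γ u U).predictive n y =
      expLocation γ u U t n y := fun y => by
    rw [Measure.restrict_univ]
    exact integral_exp_stableLaw hu huU t _ n
  -- Disintegrating the law of (prefix, next term) reduces the martingale property to the one-step
  -- identity `e2`.
  rw [e1, ← Strategy.map_measure_compProd, Measure.setIntegral_compProd hs .univ
    (by rw [Strategy.map_measure_compProd]; exact hgi.integrableOn)]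
  simp_rw [e2]
  rw [setIntegral_map hs (measurable_expLocation γ u U t n).aestronglyMeasurable hm.aemeasurable]

/-- The martingale has constant mean, and it starts at `1` because `f_0 = 0` and `u 0 = 0`. -/
lemma charFun_map_location (hu0 : u 0 = 0) (hu : StrictMono u) (huU : ∀ n, u n < U)
    (t : ℝ) (n : ℕ) :
    ∫ x, Complex.exp (t * location γ u U n (fun i => x i) * Complex.I)
      ∂(stableStrategy γ u U).measure = Complex.exp (-((u n * |t| ^ (γ : ℝ) / 2 : ℝ) : ℂ)) := by
  have h := (martingale_expLocation (γ := γ) hu huU t).setIntegral_eq (Nat.zero_le n)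
    (MeasurableSet.univ)
  simp only [setIntegral_univ] at h
  simp only [expLocation, hu0, location, Complex.exp_add] at h
  rw [Complex.exp_neg, ← mul_left_inj' (Complex.exp_ne_zero _), inv_mul_cancel₀ (Complex.exp_ne_zero _),
    ← integral_mul_const, ← h]
  simp


/-! ### Almost sure convergence of the locations -/

/-- A real sequence converges as soon as its characters converge at almost every frequency. -/
lemma exists_tendsto_of_ae_exp_tendsto (a : ℕ → ℝ)
    (h : ∀ᵐ t : ℝ ∂gaussianReal 0 1, ∃ c : ℂ,
      Tendsto (fun n => Complex.exp (t * a n * Complex.I)) atTop (𝓝 c)) :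
    ∃ l : ℝ, Tendsto a atTop (𝓝 l) := by
  -- This is the Gaussian average over `t` of `exp (i t (a_m - a_n))`, a ratio of characters tending
  -- to `1` for almost every `t`; the limits have modulus `1`, so division is allowed.
  have key : Tendsto (fun p : ℕ × ℕ => Real.exp (-(a p.1 - a p.2) ^ 2 / 2)) atTop (𝓝 1) := by
    have h1 : Tendsto (fun p : ℕ × ℕ => ∫ t : ℝ, Complex.exp (t * (a p.1 - a p.2 : ℝ) * Complex.I)
        ∂gaussianReal 0 1) atTop (𝓝 (∫ _, 1 ∂gaussianReal 0 1)) := by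
      refine tendsto_integral_filter_of_dominated_convergence (fun _ => 1)
        (.of_forall fun p => by fun_prop) (.of_forall fun p => ae_of_all _ fun t => ?_)
        (integrable_const _) ?_
      · rw [← Complex.ofReal_mul, Complex.norm_exp_ofReal_mul_I]
      · filter_upwards [h] with t ⟨c, hc⟩
        have hc1 : ‖c‖ = 1 := by
          refine tendsto_nhds_unique hc.norm (tendsto_const_nhds.congr fun n => ?_)
          rw [← Complex.ofReal_mul, Complex.norm_exp_ofReal_mul_I]
        have hc0 : c ≠ 0 := by
          rintro rfl
          simp at hc1
        rw [← prod_atTop_atTop_eq, ← div_self hc0]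
        refine ((hc.comp tendsto_fst).div (hc.comp tendsto_snd) hc0).congr fun p => ?_
        simp only [Function.comp, Pi.div_apply]
        rw [← Complex.exp_sub]
        congr 1
        push_cast
        ring
    rw [integral_const, probReal_univ, one_smul] at h1
    have h2 := (Complex.continuous_re.tendsto _).comp h1
    rw [Complex.one_re] at h2
    refine h2.congr fun p => ?_
    have h3 := charFun_gaussianReal (μ := 0) (v := 1) (a p.1 - a p.2)
    rw [charFun_apply_real] at h3
    have e : ∀ t : ℝ, Complex.exp (t * (a p.1 - a p.2 : ℝ) * Complex.I) =
        Complex.exp ((a p.1 - a p.2 : ℝ) * t * Complex.I) := fun t => by ring_nf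
    simp only [Function.comp]
    simp_rw [e]
    rw [h3, ← Complex.ofReal_re (Real.exp _), Complex.ofReal_exp]
    congr 2
    push_cast
    simp
    ring
  refine cauchySeq_tendsto_of_complete (cauchySeq_iff_tendsto_dist_atTop_0.2 ?_)
  -- Applying `sqrt (-2 log ·)` recovers `|a_m - a_n|`, so the sequence is Cauchy.
  have h4 := ((Real.continuousAt_log one_ne_zero).tendsto.comp key)
  rw [Real.log_one] at h4
  have h5 := (Real.continuous_sqrt.tendsto _).comp (h4.const_mul (-2))
  rw [mul_zero, Real.sqrt_zero] at h5
  refine h5.congr fun p => ?_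
  simp only [Function.comp, Real.log_exp, Real.dist_eq]
  rw [← Real.sqrt_sq_eq_abs]
  congr 1
  ring

/-- The modulus is at most `exp (U |t| ^ γ / 2)`, so bounded martingale convergence applies to the
real and imaginary parts. -/
lemma ae_exists_tendsto_expLocation (hu : StrictMono u) (huU : ∀ n, u n < U) (t : ℝ) :
    ∀ᵐ x : ℕ → ℝ ∂(stableStrategy γ u U).measure, ∃ c : ℂ,
      Tendsto (fun n => expLocation γ u U t n fun i => x i) atTop (𝓝 c) := by
  have hM := martingale_expLocation (γ := γ) hu huU t
  have key : ∀ L : ℂ →L[ℝ] ℝ, ∀ᵐ x : ℕ → ℝ ∂(stableStrategy γ u U).measure, ∃ c : ℝ,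
      Tendsto (fun n => L (expLocation γ u U t n fun i => x i)) atTop (𝓝 c) := fun L => by
    have hL : Martingale (fun n (x : ℕ → ℝ) => L (expLocation γ u U t n fun i => x i))
        (prefixFiltration ℝ) (stableStrategy γ u U).measure := by
      refine martingale_of_setIntegral_eq_succ
        (fun n => L.continuous.comp_stronglyMeasurable (hM.1 n))
        (fun n => L.integrable_comp (hM.integrable n)) fun n s hs => ?_
      rw [L.integral_comp_comm (hM.integrable n).integrableOn,
        L.integral_comp_comm (hM.integrable (n + 1)).integrableOn,
        hM.setIntegral_eq n.le_succ hs]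
    refine hL.submartingale.exists_ae_tendsto_of_bdd
      (R := Real.toNNReal (‖L‖ * Real.exp (U * |t| ^ (γ : ℝ) / 2))) fun n => ?_
    refine (eLpNorm_le_of_ae_bound (C := ‖L‖ * Real.exp (U * |t| ^ (γ : ℝ) / 2))
      (ae_of_all _ fun x => (L.le_opNorm _).trans ?_)).trans ?_
    · rw [norm_expLocation]
      have := (huU n).le
      gcongr
    · simp [ENNReal.ofReal]
  filter_upwards [key Complex.reCLM, key Complex.imCLM] with x ⟨a, ha⟩ ⟨b, hb⟩
  refine ⟨a + b * Complex.I, ?_⟩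
  refine (((Complex.continuous_ofReal.tendsto _).comp ha).add
    (((Complex.continuous_ofReal.tendsto _).comp hb).mul_const Complex.I)).congr fun n => ?_
  simp [Complex.re_add_im]

lemma tendsto_atTop_iSup_of_bounded (hu : StrictMono u) (huU : ∀ n, u n < U) :
    Tendsto u atTop (𝓝 (iSup u)) :=
  tendsto_atTop_ciSup hu.monotone ⟨U, by rintro _ ⟨n, rfl⟩; exact (huU n).le⟩

lemma ae_mem_convSet (hu : StrictMono u) (huU : ∀ n, u n < U) :
    ∀ᵐ x ∂(stableStrategy γ u U).measure, x ∈ convSet γ u U := by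
  have hm : ∀ n, Measurable fun p : (ℕ → ℝ) × ℝ =>
      Complex.exp (p.2 * location γ u U n (fun i => p.1 i) * Complex.I) := fun n => by
    have : Measurable fun p : (ℕ → ℝ) × ℝ => location γ u U n (fun i => p.1 i) :=
      (measurable_location γ u U n).comp (by fun_prop)
    fun_prop
  have h : ∀ᵐ x ∂(stableStrategy γ u U).measure, ∀ᵐ t : ℝ ∂gaussianReal 0 1, ∃ c : ℂ,
      Tendsto (fun n => Complex.exp (t * location γ u U n (fun i => x i) * Complex.I))
        atTop (𝓝 c) := by
    -- The exceptional null set depends on `t`; Fubini exchanges the two quantifiers.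
    rw [Measure.ae_ae_comm (measurableSet_exists_tendsto hm)]
    refine ae_of_all _ fun t => ?_
    filter_upwards [ae_exists_tendsto_expLocation hu huU t] with x ⟨c, hc⟩
    have h1 : Tendsto (fun n => Complex.exp (-((u n * |t| ^ (γ : ℝ) / 2 : ℝ) : ℂ))) atTop
        (𝓝 (Complex.exp (-((iSup u * |t| ^ (γ : ℝ) / 2 : ℝ) : ℂ)))) := by
      have hc : Continuous fun v : ℝ => Complex.exp (-((v * |t| ^ (γ : ℝ) / 2 : ℝ) : ℂ)) := by
        fun_prop
      exact (hc.tendsto _).comp (tendsto_atTop_iSup_of_bounded hu huU)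
    refine ⟨_, (hc.mul h1).congr fun n => ?_⟩
    rw [expLocation, ← Complex.exp_add]
    congr 1
    ring
  filter_upwards [h] with x hx
  exact exists_tendsto_of_ae_exp_tendsto _ hx

/-! ### Law of the limit -/

lemma tendsto_limitLocation {x : ℕ → ℝ} (hx : x ∈ convSet γ u U) :
    Tendsto (fun n => location γ u U n fun i => x i) atTop (𝓝 (limitLocation γ u U x)) :=
  tendsto_nhds_limUnder hx

lemma aemeasurable_limitLocation (hu : StrictMono u) (huU : ∀ n, u n < U) :
    AEMeasurable (limitLocation γ u U) (stableStrategy γ u U).measure :=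
  aemeasurable_of_tendsto_metrizable_ae atTop
    (fun n => ((measurable_location γ u U n).comp (by fun_prop)).aemeasurable)
    ((ae_mem_convSet hu huU).mono fun _ hx => tendsto_limitLocation hx)

lemma map_limitLocation (hu0 : u 0 = 0) (hu : StrictMono u) (huU : ∀ n, u n < U) :
    (stableStrategy γ u U).measure.map (limitLocation γ u U) = stableLaw γ 0 (iSup u) := by
  have hf := aemeasurable_limitLocation (γ := γ) hu huU
  have := Measure.isProbabilityMeasure_map hf
  have hlim := tendsto_atTop_iSup_of_bounded hu huU
  have h0 : 0 ≤ iSup u := ge_of_tendsto' hlim fun n => hu0 ▸ hu.monotone (Nat.zero_le n)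
  refine Measure.ext_of_charFun (funext fun t => ?_)
  rw [charFun_stableLaw γ 0 h0, charFun_apply_real, integral_map hf (by fun_prop)]
  have hm : ∀ n, Measurable fun x : ℕ → ℝ => location γ u U n (fun i => x i) := fun n =>
    (measurable_location γ u U n).comp (by fun_prop)
  have h1 : Tendsto (fun n => ∫ x, Complex.exp (t * location γ u U n (fun i => x i) * Complex.I)
      ∂(stableStrategy γ u U).measure) atTop
      (𝓝 (∫ x, Complex.exp (t * limitLocation γ u U x * Complex.I)
        ∂(stableStrategy γ u U).measure)) := by
    refine tendsto_integral_of_dominated_convergence (fun _ => 1)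
      (fun n => ((show Continuous fun a : ℝ => Complex.exp (t * a * Complex.I) by
        fun_prop).measurable.comp (hm n)).aestronglyMeasurable) (integrable_const _)
      (fun n => ae_of_all _ fun x => ?_) ?_
    · rw [← Complex.ofReal_mul, Complex.norm_exp_ofReal_mul_I]
    · filter_upwards [ae_mem_convSet hu huU] with x hx
      have hc : Continuous fun a : ℝ => Complex.exp (t * a * Complex.I) := by fun_prop
      exact (hc.tendsto _).comp (tendsto_limitLocation hx)
  refine tendsto_nhds_unique h1 ?_
  simp_rw [charFun_map_location hu0 hu huU]
  have hc : Continuous fun v : ℝ =>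
      Complex.exp (t * (0 : ℝ) * Complex.I - ((v * |t| ^ (γ : ℝ) / 2 : ℝ) : ℂ)) := by fun_prop
  refine ((hc.tendsto _).comp hlim).congr fun n => ?_
  simp

/-! ### Weak convergence to a point mass -/

lemma law_stableStrategy (n : ℕ) (x : ℕ → ℝ) :
    (stableStrategy γ u U).law n x =
      stableLaw γ (location γ u U n fun i => x i) (U - u n) := rfl

lemma tendsto_stableLaw_diracProba {a b : ℕ → ℝ} {l : ℝ} (hb0 : ∀ n, 0 ≤ b n)
    (ha : Tendsto a atTop (𝓝 l)) (hb : Tendsto b atTop (𝓝 0)) :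
    Tendsto (fun n => stableLaw γ (a n) (b n)) atTop (𝓝 (diracProba l)) := by
  refine ProbabilityMeasure.tendsto_iff_tendsto_charFun.2 fun t => ?_
  simp_rw [charFun_stableLaw γ _ (hb0 _)]
  -- The point mass fits the stable formula with scale `0`, so joint continuity in location and
  -- scale suffices.
  have e : charFun (diracProba l : Measure ℝ) t =
      Complex.exp (t * l * Complex.I - ((0 * |t| ^ (γ : ℝ) / 2 : ℝ) : ℂ)) := by
    simp [diracProba]
  rw [e]
  have hc : Continuous fun p : ℝ × ℝ =>
      Complex.exp (t * p.1 * Complex.I - ((p.2 * |t| ^ (γ : ℝ) / 2 : ℝ) : ℂ)) := by fun_prop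
  have h := (hc.tendsto (l, 0)).comp (ha.prodMk_nhds hb)
  exact h


/-! ### Absolute continuity from integrability of the characteristic function -/

lemma integral_gaussian_exp_mul_I (s : ℝ) :
    ∫ v : ℝ, Complex.exp (s * v * Complex.I) ∂gaussianReal 0 1 =
      (Real.exp (-s ^ 2 / 2) : ℂ) := by
  rw [← charFun_apply_real, charFun_gaussianReal]
  push_cast
  congr 1
  simp
  ring

lemma gaussianPDFReal_zero_one_le_one (v : ℝ) : gaussianPDFReal 0 1 v ≤ 1 := by
  unfold gaussianPDFReal
  refine mul_le_one₀ (inv_le_one_of_one_le₀ ?_) (Real.exp_pos _).le (Real.exp_le_one_iff.2 ?_)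
  · rw [Real.one_le_sqrt]
    simp only [NNReal.coe_one, mul_one]
    linarith [Real.pi_gt_three]
  · have := sq_nonneg (v - 0)
    simp only [NNReal.coe_one]
    linarith

/-- A Gaussian bump is an average of characters, so by Fubini its integral is a Gaussian average of
the characteristic function at `v / h`, up to phases. The Gaussian density is at most `1`, and
rescaling `v` yields the factor `h`. -/
lemma integral_gaussian_kernel_le (μ : Measure ℝ) [IsProbabilityMeasure μ]
    (hμ : Integrable (charFun μ)) (x : ℝ) {h : ℝ} (hh : 0 < h) :
    ∫ y, Real.exp (-((y - x) / h) ^ 2 / 2) ∂μ ≤ h * ∫ t, ‖charFun μ t‖ := by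
  have hi : Integrable (Function.uncurry fun (y v : ℝ) =>
      Complex.exp (((y - x) / h : ℝ) * v * Complex.I)) (μ.prod (gaussianReal 0 1)) := by
    refine Integrable.of_bound (C := 1) ?_ (ae_of_all _ fun p => ?_)
    · refine Continuous.aestronglyMeasurable ?_
      unfold Function.uncurry
      fun_prop
    · simp only [Function.uncurry]
      rw [← Complex.ofReal_mul, Complex.norm_exp_ofReal_mul_I]
  have e : ((∫ y, Real.exp (-((y - x) / h) ^ 2 / 2) ∂μ : ℝ) : ℂ) =
      ∫ v : ℝ, charFun μ (h⁻¹ * v) * Complex.exp ((-(v * x / h) : ℝ) * Complex.I)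
        ∂gaussianReal 0 1 := by
    rw [← integral_complex_ofReal]
    simp_rw [← integral_gaussian_exp_mul_I]
    rw [integral_integral_swap hi]
    refine integral_congr_ae (ae_of_all _ fun v => ?_)
    simp only
    rw [charFun_apply_real, ← integral_mul_const]
    refine integral_congr_ae (ae_of_all _ fun y => ?_)
    simp only
    rw [← Complex.exp_add]
    congr 1
    push_cast
    field_simp
    ring
  have hi2 : Integrable fun v => ‖charFun μ (h⁻¹ * v)‖ :=
    (hμ.comp_mul_left' (inv_ne_zero hh.ne')).norm
  have hnn : 0 ≤ ∫ y, Real.exp (-((y - x) / h) ^ 2 / 2) ∂μ :=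
    integral_nonneg fun y => (Real.exp_pos _).le
  calc ∫ y, Real.exp (-((y - x) / h) ^ 2 / 2) ∂μ
      = ‖((∫ y, Real.exp (-((y - x) / h) ^ 2 / 2) ∂μ : ℝ) : ℂ)‖ := by
        rw [Complex.norm_real, Real.norm_of_nonneg hnn]
    _ ≤ ∫ v, ‖charFun μ (h⁻¹ * v)‖ ∂gaussianReal 0 1 := by
        rw [e]
        refine (norm_integral_le_integral_norm _).trans_eq ?_
        refine integral_congr_ae (ae_of_all _ fun v => ?_)
        simp only
        rw [norm_mul, Complex.norm_exp_ofReal_mul_I, mul_one]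
    _ = ∫ v, gaussianPDFReal 0 1 v * ‖charFun μ (h⁻¹ * v)‖ := by
        rw [integral_gaussianReal_eq_integral_smul one_ne_zero]
        rfl
    _ ≤ ∫ v, ‖charFun μ (h⁻¹ * v)‖ := by
        have hle : ∀ v, gaussianPDFReal 0 1 v * ‖charFun μ (h⁻¹ * v)‖ ≤ ‖charFun μ (h⁻¹ * v)‖ :=
          fun v => mul_le_of_le_one_left (norm_nonneg _) (gaussianPDFReal_zero_one_le_one v)
        refine integral_mono_of_nonneg (ae_of_all _ fun v => ?_) hi2 (ae_of_all _ hle)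
        exact mul_nonneg (gaussianPDFReal_nonneg _ _ _) (norm_nonneg _)
    _ = h * ∫ t, ‖charFun μ t‖ := by
        rw [Measure.integral_comp_mul_left (fun t => ‖charFun μ t‖), inv_inv, abs_of_pos hh,
          smul_eq_mul]

lemma exists_measureReal_Ioc_le (μ : Measure ℝ) [IsProbabilityMeasure μ]
    (hμ : Integrable (charFun μ)) :
    ∃ C : NNReal, ∀ a b : ℝ, a ≤ b → μ.real (Set.Ioc a b) ≤ C * (b - a) := by
  -- On `(a, b]` the bump centred at `a` of width `b - a` is at least `exp (-1 / 2)`.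
  refine ⟨⟨Real.exp (1 / 2) * ∫ t, ‖charFun μ t‖, by positivity⟩, fun a b hab => ?_⟩
  rcases hab.eq_or_lt with rfl | hab
  · simp
  have hh : 0 < b - a := sub_pos.2 hab
  have h1 := integral_gaussian_kernel_le μ hμ a hh
  have hi : Integrable (fun y => Real.exp (1 / 2) * Real.exp (-((y - a) / (b - a)) ^ 2 / 2)) μ := by
    refine (Integrable.of_bound (C := 1) (by fun_prop) (ae_of_all _ fun y => ?_)).const_mul _
    rw [Real.norm_of_nonneg (Real.exp_pos _).le, Real.exp_le_one_iff]
    linarith [sq_nonneg ((y - a) / (b - a))]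
  have h2 : μ.real (Set.Ioc a b) ≤
      ∫ y, Real.exp (1 / 2) * Real.exp (-((y - a) / (b - a)) ^ 2 / 2) ∂μ := by
    rw [← integral_indicator_one measurableSet_Ioc]
    refine integral_mono ((integrable_const _).indicator measurableSet_Ioc) hi fun y => ?_
    rw [← Real.exp_add]
    by_cases hy : y ∈ Set.Ioc a b
    · rw [Set.indicator_of_mem hy, Pi.one_apply, Real.one_le_exp_iff]
      have h3 : 0 ≤ (y - a) / (b - a) := div_nonneg (sub_nonneg.2 hy.1.le) hh.le
      have h4 : (y - a) / (b - a) ≤ 1 := (div_le_one hh).2 (by linarith [hy.2])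
      nlinarith
    · rw [Set.indicator_of_notMem hy]
      positivity
  rw [integral_const_mul] at h2
  refine h2.trans ((mul_le_mul_of_nonneg_left h1 (Real.exp_pos _).le).trans_eq ?_)
  change _ = Real.exp (1 / 2) * (∫ t, ‖charFun μ t‖) * (b - a)
  ring

/-- The distribution function is `C`-Lipschitz, so `C x - cdf μ x` is again a Stieltjes function.
Adding its measure to `μ` gives `C` times Lebesgue measure, whence `μ ≤ C • volume`. -/
lemma absolutelyContinuous_of_measureReal_Ioc_le (μ : Measure ℝ) [IsProbabilityMeasure μ]
    (C : NNReal) (hC : ∀ a b : ℝ, a ≤ b → μ.real (Set.Ioc a b) ≤ C * (b - a)) :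
    μ ≪ volume := by
  have hcdf : ∀ a b : ℝ, a ≤ b → cdf μ b - cdf μ a = μ.real (Set.Ioc a b) := fun a b hab => by
    rw [cdf_eq_real, cdf_eq_real,
      ← measureReal_sdiff (Set.Iic_subset_Iic.2 hab) measurableSet_Iic, Set.Iic_sdiff_Iic]
  let G : StieltjesFunction ℝ :=
    { toFun := fun x => C * x - cdf μ x
      mono' := fun a b hab => by
        have := hC a b hab
        have := hcdf a b hab
        simp only
        linarith
      right_continuous' := fun x =>
        (by fun_prop : ContinuousWithinAt (fun x : ℝ => C * x) (Set.Ici x) x).sub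
          ((cdf μ).right_continuous x) }
  have e : cdf μ + G = C • StieltjesFunction.id := by
    ext x
    simp only [G, StieltjesFunction.add_apply]
    exact add_sub_cancel _ _
  have h := StieltjesFunction.measure_add (cdf μ) G
  rw [e, StieltjesFunction.measure_smul, measure_cdf, ← Real.volume_eq_stieltjes_id] at h
  refine Measure.absolutelyContinuous_of_le_smul (c := C) ?_
  have h2 : μ ≤ μ + G.measure := Measure.le_add_right le_rfl
  rw [← h] at h2
  exact h2

lemma integrable_charFun_stdStable (γ : Set.Ioc (0 : ℝ) 2) :
    Integrable (charFun (stdStable γ : Measure ℝ)) := by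
  have hγ : (0 : ℝ) < γ := γ.2.1
  have h := (integrableOn_rpow_mul_exp_neg_mul_rpow (s := 0) (b := 1 / 2) (p := (γ : ℝ))
    (by norm_num) hγ (by norm_num)).integrable_indicator measurableSet_Ioi
  refine (h.add h.comp_neg).mono' (by fun_prop) ?_
  -- The dominating function is a sum over the two open half-lines and vanishes at `0`, where the
  -- bound fails.
  filter_upwards [Measure.ae_ne volume (0 : ℝ)] with t ht
  rw [charFun_stdStable, ← Complex.ofReal_neg, ← Complex.ofReal_exp, Complex.norm_real,
    Real.norm_of_nonneg (Real.exp_pos _).le]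
  rcases ht.lt_or_gt with h0 | h0
  · simp [h0, h0.not_gt, abs_of_neg h0]
    exact le_of_eq (by ring_nf)
  · simp [h0, h0.not_gt, abs_of_pos h0]
    exact le_of_eq (by ring_nf)

lemma stdStable_absolutelyContinuous (γ : Set.Ioc (0 : ℝ) 2) :
    (stdStable γ : Measure ℝ) ≪ volume := by
  obtain ⟨C, hC⟩ := exists_measureReal_Ioc_le _ (integrable_charFun_stdStable γ)
  exact absolutelyContinuous_of_measureReal_Ioc_le _ C hC

/-! ### Continuity of affine images in total variation -/

lemma tendsto_integral_abs_affine_sub {g : ℝ → ℝ} (hg : Continuous g) (hgc : HasCompactSupport g)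
    {a s : ℕ → ℝ} {a₀ s₀ : ℝ} (hs₀ : 0 < s₀) (ha : Tendsto a atTop (𝓝 a₀))
    (hs : Tendsto s atTop (𝓝 s₀)) :
    Tendsto (fun n => ∫ x, |(s n)⁻¹ * g ((x - a n) / s n) - s₀⁻¹ * g ((x - a₀) / s₀)|)
      atTop (𝓝 0) := by
  obtain ⟨M, hM⟩ := hgc.exists_bound_of_continuous hg
  obtain ⟨R, hR⟩ := hgc.isCompact.isBounded.subset_closedBall 0
  have hM0 : 0 ≤ M := (norm_nonneg _).trans (hM 0)
  -- Large enough that `[-R', R']` contains the supports of all rescaled copies with shift at most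
  -- `|a₀| + 1` in modulus and scale in `[s₀ / 2, s₀ + 1]`.
  let R' : ℝ := |a₀| + 1 + |R| * (s₀ + 1)
  have key : ∀ b r : ℝ, s₀ / 2 ≤ r → r ≤ s₀ + 1 → |b| ≤ |a₀| + 1 → ∀ x,
      |r⁻¹ * g ((x - b) / r)| ≤
        (Set.Icc (-R') R').indicator (fun _ => (s₀ / 2)⁻¹ * M) x := fun b r hr hr' hb x => by
    have hr0 : 0 < r := lt_of_lt_of_le (by positivity) hr
    by_cases hx : x ∈ Set.Icc (-R') R'
    · rw [Set.indicator_of_mem hx, abs_mul, abs_of_pos (inv_pos.2 hr0)]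
      have := hM ((x - b) / r)
      rw [Real.norm_eq_abs] at this
      gcongr
    · rw [Set.indicator_of_notMem hx]
      have : g ((x - b) / r) = 0 := by
        by_contra hne
        have h1 := hR (subset_tsupport g hne)
        rw [mem_closedBall_zero_iff, Real.norm_eq_abs, abs_div, abs_of_pos hr0,
          div_le_iff₀ hr0] at h1
        refine hx (abs_le.1 ?_)
        have h2 : R * r ≤ |R| * (s₀ + 1) := by
          have := le_abs_self R
          gcongr
        have h3 := abs_add_le (x - b) b
        rw [sub_add_cancel] at h3
        simp only [R']
        linarith
      simp [this]
  have hev : ∀ᶠ n in atTop, s₀ / 2 ≤ s n ∧ s n ≤ s₀ + 1 ∧ |a n| ≤ |a₀| + 1 :=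
    (hs.eventually_const_le (by linarith)).and ((hs.eventually_le_const (by linarith)).and
      (ha.abs.eventually_le_const (by linarith)))
  have hlim := tendsto_integral_filter_of_dominated_convergence (μ := volume) (l := atTop)
    (F := fun n x => |(s n)⁻¹ * g ((x - a n) / s n) - s₀⁻¹ * g ((x - a₀) / s₀)|)
    (f := fun _ => 0)
    (fun x => 2 * (Set.Icc (-R') R').indicator (fun _ => (s₀ / 2)⁻¹ * M) x)
    (.of_forall fun n => by fun_prop) ?_ ?_ ?_
  · simpa using hlim
  · filter_upwards [hev] with n hn
    refine ae_of_all _ fun x => ?_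
    rw [Real.norm_eq_abs, abs_abs, two_mul]
    refine (abs_sub _ _).trans (add_le_add (key _ _ hn.1 hn.2.1 hn.2.2 x)
      (key _ _ (by linarith) (by linarith) (by linarith) x))
  · refine Integrable.const_mul ?_ _
    exact (integrable_indicator_iff measurableSet_Icc).2 (integrableOn_const (by simp))
  · refine ae_of_all _ fun x => ?_
    have h1 : Tendsto (fun n => (s n)⁻¹ * g ((x - a n) / s n)) atTop
        (𝓝 (s₀⁻¹ * g ((x - a₀) / s₀))) :=
      (hs.inv₀ hs₀.ne').mul ((hg.tendsto _).comp ((tendsto_const_nhds.sub ha).div hs hs₀.ne'))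
    simpa using (h1.sub_const (s₀⁻¹ * g ((x - a₀) / s₀))).abs

lemma setIntegral_affine_preimage (g : ℝ → ℝ) (a : ℝ) {s : ℝ} (hs : 0 < s) {A : Set ℝ}
    (hA : MeasurableSet A) :
    ∫ z in (fun z => a + s * z) ⁻¹' A, g z = ∫ x in A, s⁻¹ * g ((x - a) / s) := by
  have hm : MeasurableSet ((fun z => a + s * z) ⁻¹' A) :=
    (show Measurable fun z : ℝ => a + s * z by fun_prop) hA
  rw [← integral_indicator hm, ← integral_indicator hA]
  let G : ℝ → ℝ := A.indicator fun x => g ((x - a) / s)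
  have e1 : ∀ z, ((fun z => a + s * z) ⁻¹' A).indicator g z = G (a + s * z) := fun z => by
    by_cases hz : a + s * z ∈ A
    · rw [Set.indicator_of_mem (show z ∈ (fun z => a + s * z) ⁻¹' A from hz)]
      simp only [G]
      rw [Set.indicator_of_mem hz, add_sub_cancel_left, mul_div_cancel_left₀ _ hs.ne']
    · rw [Set.indicator_of_notMem (show z ∉ (fun z => a + s * z) ⁻¹' A from hz)]
      simp only [G]
      rw [Set.indicator_of_notMem hz]
  have e2 : ∀ x, A.indicator (fun x => s⁻¹ * g ((x - a) / s)) x = s⁻¹ * G x := fun x => by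
    by_cases hx : x ∈ A <;> simp [G, hx]
  simp_rw [e1, e2]
  rw [Measure.integral_comp_mul_left (fun y => G (a + y)), integral_add_left_eq_self,
    abs_of_pos (inv_pos.2 hs), smul_eq_mul, integral_const_mul]

/-- The density is approximated in `L¹` by a continuous compactly supported `g`, for which dominated
convergence gives the claim uniformly in `A`. -/
lemma tendsto_iSup_abs_map_affine_sub (μ : Measure ℝ) [IsProbabilityMeasure μ] (hμ : μ ≪ volume)
    {a s : ℕ → ℝ} {a₀ s₀ : ℝ} (hs0 : ∀ n, 0 < s n) (hs₀ : 0 < s₀)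
    (ha : Tendsto a atTop (𝓝 a₀)) (hs : Tendsto s atTop (𝓝 s₀)) :
    Tendsto (fun n => ⨆ A : {A : Set ℝ // MeasurableSet A},
      |(μ.map fun z => a n + s n * z).real A - (μ.map fun z => a₀ + s₀ * z).real A|)
      atTop (𝓝 0) := by
  let p : ℝ → ℝ := fun x => (μ.rnDeriv volume x).toReal
  have hp : Integrable p := Measure.integrable_toReal_rnDeriv
  refine tendsto_order.2 ⟨fun b hb => .of_forall fun n =>
    hb.trans_le (Real.iSup_nonneg fun _ => abs_nonneg _), fun ε hε => ?_⟩
  obtain ⟨g, hgc, hpg, hg, hgi⟩ :=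
    hp.exists_hasCompactSupport_integral_sub_le (show 0 < ε / 4 by positivity)
  let D : ℕ → ℝ := fun n => ∫ x, |(s n)⁻¹ * g ((x - a n) / s n) - s₀⁻¹ * g ((x - a₀) / s₀)|
  have hD : Tendsto D atTop (𝓝 0) := tendsto_integral_abs_affine_sub hg hgc hs₀ ha hs
  filter_upwards [hD.eventually_lt_const (show 0 < ε / 4 by positivity)] with n hn
  -- Pulling `A` back along the affine map makes the approximation error independent of `b`, `r` and
  -- `A`.
  have happ : ∀ b r : ℝ, 0 < r → ∀ A : Set ℝ, MeasurableSet A →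
      |(μ.map fun z => b + r * z).real A - ∫ x in A, r⁻¹ * g ((x - b) / r)| ≤ ε / 4 := by
    intro b r hr A hA
    rw [map_measureReal_apply (by fun_prop) hA, ← setIntegral_affine_preimage g b hr hA,
      ← Measure.setIntegral_toReal_rnDeriv hμ, ← integral_sub hp.integrableOn hgi.integrableOn]
    rw [← Real.norm_eq_abs]
    refine (norm_integral_le_integral_norm _).trans (le_trans ?_ hpg)
    exact setIntegral_le_integral (hp.sub hgi).norm (ae_of_all _ fun _ => norm_nonneg _)
  have hint : ∀ b r : ℝ, 0 < r → Integrable fun x => r⁻¹ * g ((x - b) / r) := fun b r hr =>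
    ((hgi.comp_div hr.ne').comp_sub_right b).const_mul r⁻¹
  refine lt_of_le_of_lt (b := 3 * (ε / 4)) (Real.iSup_le (fun ⟨A, hA⟩ => ?_) (by positivity))
    (by linarith)
  have h1 := happ (a n) (s n) (hs0 n) A hA
  have h2 := happ a₀ s₀ hs₀ A hA
  have h3 : |(∫ x in A, (s n)⁻¹ * g ((x - a n) / s n)) - ∫ x in A, s₀⁻¹ * g ((x - a₀) / s₀)| ≤
      D n := by
    have i1 := hint (a n) (s n) (hs0 n)
    have i2 := hint a₀ s₀ hs₀
    rw [← integral_sub i1.integrableOn i2.integrableOn]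
    rw [← Real.norm_eq_abs]
    refine (norm_integral_le_integral_norm _).trans ?_
    exact setIntegral_le_integral (i1.sub i2).norm (ae_of_all _ fun _ => norm_nonneg _)
  rw [abs_le] at h1 h2 h3 ⊢
  constructor <;> linarith [h1.1, h1.2, h2.1, h2.2, h3.1, h3.2]

lemma tendsto_tvDist_stableLaw (γ : Set.Ioc (0 : ℝ) 2) {a b : ℕ → ℝ} {a₀ b₀ : ℝ}
    (hb : ∀ n, 0 < b n) (hb₀ : 0 < b₀) (ha : Tendsto a atTop (𝓝 a₀))
    (hlim : Tendsto b atTop (𝓝 b₀)) :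
    Tendsto (fun n => tvDist (stableLaw γ (a n) (b n)) (stableLaw γ a₀ b₀)) atTop (𝓝 0) := by
  simp only [tvDist, stableLaw, ProbabilityMeasure.toMeasure_map]
  exact tendsto_iSup_abs_map_affine_sub _ (stdStable_absolutelyContinuous γ)
    (fun n => Real.rpow_pos_of_pos (hb n) _) (Real.rpow_pos_of_pos hb₀ _) ha
    (hlim.rpow_const (.inl hb₀.ne'))

end StablePrediction

theorem mainTheorem3 (γ : Set.Ioc (0 : ℝ) 2) (u : ℕ → ℝ) (U : ℝ)
    (hu0 : u 0 = 0) (hu : StrictMono u) (huU : ∀ n, u n < U) :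
    (∀ x ∈ StablePrediction.convSet γ u U,
      (iSup u = U →
        Tendsto (fun n => (StablePrediction.stableStrategy γ u U).law n x) atTop
          (𝓝 (diracProba (StablePrediction.limitLocation γ u U x)))) ∧
      (iSup u < U →
        Tendsto (fun n => StablePrediction.tvDist
            ((StablePrediction.stableStrategy γ u U).law n x)
            (StablePrediction.stableLaw γ (StablePrediction.limitLocation γ u U x)
              (U - iSup u))) atTop (𝓝 0))) ∧
    (StablePrediction.stableStrategy γ u U).measure (StablePrediction.convSet γ u U) = 1 ∧
    ∀ A : Set ℝ, MeasurableSet A →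
      (StablePrediction.stableStrategy γ u U).measure
          {x | x ∈ StablePrediction.convSet γ u U ∧
            StablePrediction.limitLocation γ u U x ∈ A} =
        (StablePrediction.stableLaw γ 0 (iSup u) : Measure ℝ) A := by
  have hlim := (StablePrediction.tendsto_atTop_iSup_of_bounded hu huU).const_sub U
  have hae := StablePrediction.ae_mem_convSet (γ := γ) hu huU
  refine ⟨fun x hx => ⟨fun h => ?_, fun h => ?_⟩, ?_, fun A hA => ?_⟩
  · simp_rw [StablePrediction.law_stableStrategy]
    rw [h, sub_self] at hlim
    exact StablePrediction.tendsto_stableLaw_diracProba (fun n => (sub_pos.2 (huU n)).le)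
      (StablePrediction.tendsto_limitLocation hx) hlim
  · simp_rw [StablePrediction.law_stableStrategy]
    exact StablePrediction.tendsto_tvDist_stableLaw γ (fun n => sub_pos.2 (huU n)) (sub_pos.2 h)
      (StablePrediction.tendsto_limitLocation hx) hlim
  · exact (measure_congr (eventuallyEq_univ.2 hae)).trans measure_univ
  · rw [← StablePrediction.map_limitLocation hu0 hu huU,
      Measure.map_apply_of_aemeasurable (StablePrediction.aemeasurable_limitLocation hu huU) hA]
    refine measure_congr ?_
    filter_upwards [hae] with x hx
    exact propext ⟨fun h => h.2, fun h => ⟨hx, h⟩⟩
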